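/- \textbf{Setting.} Let $M$ be a finite simplicial complex or a finite cubical complex (a finite set of simplices, respectively of hypercubes, in a Euclidean space, closed under taking faces, any two of which are disjoint or intersect in a common face) with a fixed linear ordering of the vertices; in the cubical case assume that the minimal and the maximal vertices of each $2$-dimensional face are opposite. For a face $f$ let $\min f$ and $\max f$ be its minimal and maximal vertices, and write $ab$ for the edge with endpoints $a<b$. Denote by $C^k(M;V)=C_k(M;V)$ the set of $V$-valued functions on the $k$-dimensional faces. Let $G$ be a Lie group represented by unitary transformations of $\mathbb{C}^n$; elements of $G$ are identified with the corresponding $n\times n$ matrices. Let $T_uG\subset\mathbb{C}^{n\times n}$ be the real linear tangent subspace to $G$ at $u$ (the image of the differential at $u$ of the representation), and let $\mathrm{Pr}_{T_uG}\colon\mathbb{C}^{n\times n}\to T_uG$ be the orthogonal projection with respect to the scalar product $\langle u,v\rangle=\mathrm{Re}\,\mathrm{Tr}[u^*v]$. A gauge group field is an element $U\in C^1(M;G)$; its connection is $A=A[U]=U-1$. For $U\in C^1(M;\mathbb{C}^{n\times n})$ the curvature $F[U]\in C^2(M;\mathbb{C}^{n\times n})$ equals $U(ab)U(bc)-U(ac)$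 on a triangle with vertices $a<b<c$, and $U(ab)U(bc)-U(ad)U(dc)$ on a square with vertices $a<b<d<c$. For $\Phi,\Psi\in C^1(M;\mathbb{C}^{n\times n})$ and a vertex $v$ put $$[\Phi\frown\Psi](v)=\sum_{e:\max e=v}\Phi(e)\Psi(e),\qquad [\Phi\stackrel{*}{\frown}\Psi](v)=\sum_{e:\min e=v}\Phi(e)\Psi(e),$$ $$[\partial\Phi](v)=\sum_{e:\max e=v}\Phi(e)-\sum_{e:\min e=v}\Phi(e),\qquad D_A^*\Phi=\partial\Phi+(\Phi^*\frown A)^*-(A\stackrel{*}{\frown}\Phi^*)^*.$$ For $j\in C_1(M;\mathbb{C}^{n\times n})$ put $[\mathrm{Pr}_{T_UG}\,j](e)=\mathrm{Pr}_{T_{U(e)}G}\,j(e)$. A \emph{local Lagrangian} is a differentiable map $\mathcal{L}\colon C^1(M;\mathbb{C}^{n\times n})\to C_0(M;\mathbb{R})$ such that for each vertex $v$ the value $\mathcal{L}[U](v)$ is a fixed differentiable function $L_v$ of the values of $U$ at the edges $e$ with $\max e=v$ and of the values of $F[U]$ at the $2$-dimensional faces $f$ with $\max f=v$. A map $\mathcal{L}'\colon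 C^1(M;\mathbb{C}^{n\times n})\to C_0(M;\mathbb{R})$ is \emph{gauge invariant}, if $\mathcal{L}'[g^*\smile U\smile g]=\mathcal{L}'[U]$ for all $U\in C^1(M;G)$ and $g\in C^0(M;G)$, where $[g^*\smile U\smile g](e)=g(\min e)^*\,U(e)\,g(\max e)$. A gauge group field $U$ is \emph{on shell} for $\mathcal{L}$, if it is stationary for the functional $\mathcal{S}[U]=\sum_v\mathcal{L}[U](v)$ under the constraint $U\in C^1(M;G)$, that is, $\frac{d}{dt}\mathcal{S}[U_t]\big|_{t=0}=0$ for each family $U_t\in C^1(M;G)$ which is smooth near $t=0$ and satisfies $U_0=U$. \textbf{Theorem (Charge conservation for the gauge field).} Let $$\mathcal{L}[U]=\mathcal{L}'[U]-\mathrm{Re}\,\mathrm{Tr}\,[j^*\frown U]$$ be a local Lagrangian, where $j\in C_1(M;\mathbb{C}^{n\times n})$ is fixed and $\mathcal{L}'$ is gauge invariant and does not depend on $j$. Then for each gauge group field $U\in C^1(M;G)$ on shell for $\mathcal{L}$ the covariant current $j$ is conserved, i.e. $$D^*_A\,\mathrm{Pr}_{T_UG}\,j=0\qquad\text{at every vertex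 of } M.$$ -/

import Mathlib

open scoped Manifold ContDiff Matrix

noncomputable section

namespace LatticeGauge

/-! ### Spacetime: finite simplicial and cubical complexes with ordered vertices -/

/-- Whether the cells of a complex are simplices or hypercubes. -/
inductive CellKind where
  | simplicial
  | cubical

/-- The number of vertices of a `k`-dimensional simplex or hypercube. -/
def CellKind.numVertices : CellKind → ℕ → ℕ
  | .simplicial, k => k + 1
  | .cubical, k => 2 ^ k

section Cells

variable {V : Type*} {d : ℕ}

/-- `c` lists the vertices of a `k`-dimensional hypercube with vertex set `s`: the vertex `c S` is
`p + ∑ i ∈ S, w i`, where the edge vectors `w i` are pairwise orthogonal and of equal positive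
length `r`. -/
def IsCubeChart (pos : V → EuclideanSpace ℝ (Fin d)) (s : Finset V) {k : ℕ}
    (c : Finset (Fin k) → V) : Prop :=
  (s : Set V) = Set.range c ∧
    ∃ (p : EuclideanSpace ℝ (Fin d)) (w : Fin k → EuclideanSpace ℝ (Fin d)) (r : ℝ), 0 < r ∧
      (∀ i j, inner ℝ (w i) (w j) = if i = j then r ^ 2 else 0) ∧
      ∀ S, pos (c S) = p + ∑ i ∈ S, w i

/-- The points of the finite set `s` are the vertices of a simplex or of a hypercube. -/
def IsCell (pos : V → EuclideanSpace ℝ (Fin d)) (κ : CellKind) (s : Finset V) : Prop :=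
  match κ with
  | .simplicial => s.Nonempty ∧ AffineIndependent ℝ fun v : s => pos v
  | .cubical => ∃ (k : ℕ) (c : Finset (Fin k) → V), IsCubeChart pos s c

/-- `t` is the vertex set of a (nonempty) face of the cell with vertex set `s`. A face of a
hypercube is obtained by fixing some of the cube coordinates. -/
def IsFaceOf (pos : V → EuclideanSpace ℝ (Fin d)) (κ : CellKind) (t s : Finset V) : Prop :=
  match κ with
  | .simplicial => t.Nonempty ∧ t ⊆ s
  | .cubical => ∃ (k : ℕ) (c : Finset (Fin k) → V), IsCubeChart pos s c ∧
      ∃ A B : Finset (Fin k), A ⊆ B ∧ (t : Set V) = c '' Set.Icc A B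

/-- The convex hull of the points indexed by `s`. -/
def hull (pos : V → EuclideanSpace ℝ (Fin d)) (s : Finset V) : Set (EuclideanSpace ℝ (Fin d)) :=
  convexHull ℝ (pos '' s)

end Cells

/-- A spacetime: a finite simplicial or cubical complex in Euclidean space with ordered vertices.
The vertices are the elements of the finite linearly ordered type `V`, placed at the points `pos v`;
each face is recorded by its set of vertices. -/
structure Spacetime (V : Type*) [Fintype V] [LinearOrder V] (d : ℕ) where
  kind : CellKind
  pos : V → EuclideanSpace ℝ (Fin d)
  faces : Finset (Finset V)
  vertex_mem : ∀ v, {v} ∈ faces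
  isCell : ∀ s ∈ faces, IsCell pos kind s
  face_mem : ∀ s ∈ faces, ∀ t, IsFaceOf pos kind t s → t ∈ faces
  inter_face : ∀ s ∈ faces, ∀ t ∈ faces, hull pos s ∩ hull pos t = ∅ ∨
    ∃ u, IsFaceOf pos kind u s ∧ IsFaceOf pos kind u t ∧ hull pos s ∩ hull pos t = hull pos u
  /-- In a cubical complex the minimal and the maximal vertex of each 2-face are opposite. -/
  opposite : kind = .cubical → ∀ s ∈ faces, ∀ c : Finset (Fin 2) → V, IsCubeChart pos s c →
    ∃ S, IsLeast (s : Set V) (c S) ∧ IsGreatest (s : Set V) (c Sᶜ)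

namespace Spacetime

variable {V : Type*} [Fintype V] [LinearOrder V] {d : ℕ} (M : Spacetime V d)

/-- The `k`-dimensional faces. (The `0`-dimensional ones are the singletons `{v}`; functions on
vertices are taken to be functions on `V`.) -/
def Face (k : ℕ) : Type _ := {s : Finset V // s ∈ M.faces ∧ s.card = M.kind.numVertices k}

/-- The edges. -/
abbrev Edge : Type _ := M.Face 1

instance (k : ℕ) : Fintype (M.Face k) :=
  inferInstanceAs (Fintype {s : Finset V // s ∈ M.faces ∧ s.card = M.kind.numVertices k})

variable {M}

theorem Face.nonempty {k : ℕ} (f : M.Face k) : f.1.Nonempty := by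
  rw [← Finset.card_pos, f.2.2]
  cases M.kind <;> simp [CellKind.numVertices]

/-- The minimal vertex of a face. -/
def Face.minV {k : ℕ} (f : M.Face k) : V := f.1.min' f.nonempty

/-- The maximal vertex of a face. -/
def Face.maxV {k : ℕ} (f : M.Face k) : V := f.1.max' f.nonempty

variable (M)

/-- The set `e_{v,k}` of the `k`-dimensional faces whose maximal vertex is `v`. -/
abbrev FacesEndingAt (k : ℕ) (v : V) : Type _ := {f : M.Face k // f.maxV = v}

end Spacetime

/-! ### Matrix-valued (co)chains and their products -/

/-- The space `ℂ^{n×n}`. -/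
abbrev Mat (n : ℕ) : Type := Matrix (Fin n) (Fin n) ℂ

section Cochains

variable {V : Type*} [Fintype V] [LinearOrder V] {d : ℕ} (M : Spacetime V d) {n : ℕ}

/-- The cap-product of two functions on edges: `[Φ ⌢ Ψ](b) = ∑_{ab : a < b} Φ(ab) Ψ(ab)`. -/
def cap (Φ Ψ : M.Edge → Mat n) (b : V) : Mat n :=
  ∑ e : M.Edge with e.maxV = b, Φ e * Ψ e

/-- The cop-product of two functions on edges: `[Φ ⌢* Ψ](b) = ∑_{bc : c > b} Φ(bc) Ψ(bc)`. -/
def cop (Φ Ψ : M.Edge → Mat n) (b : V) : Mat n :=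
  ∑ e : M.Edge with e.minV = b, Φ e * Ψ e

/-- The boundary of a function on edges. -/
def boundary (Φ : M.Edge → Mat n) (v : V) : Mat n :=
  (∑ e : M.Edge with e.maxV = v, Φ e) - ∑ e : M.Edge with e.minV = v, Φ e

/-- The connection `A[U] = U - 1`. -/
def connection (U : M.Edge → Mat n) : M.Edge → Mat n := fun e => U e - 1

/-- The covariant boundary `D*_A Φ = ∂Φ + (Φ* ⌢ A)* - (A ⌢* Φ*)*` of a function on edges. -/
def covBoundary (A Φ : M.Edge → Mat n) (v : V) : Mat n :=
  boundary M Φ v + (cap M (fun e => (Φ e)ᴴ) A v)ᴴ - (cop M A (fun e => (Φ e)ᴴ) v)ᴴ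

/-- The value of a function on edges at the edge with the endpoints `a` and `b`
(and `0` if there is no such edge). -/
def edgeVal (U : M.Edge → Mat n) (a b : V) : Mat n :=
  if h : {a, b} ∈ M.faces ∧ ({a, b} : Finset V).card = M.kind.numVertices 1 then U ⟨{a, b}, h⟩
  else 0

/-- The curvature. On a triangle with the vertices `a < b < c` it is `U(ab)U(bc) - U(ac)`. On a
square with the vertices `a < b < d' < c`, so that `a` and `c` are opposite, it is
`U(ab)U(bc) - U(ad')U(d'c)`. A 2-face has three or four vertices, so the last case is void. -/
def curvature (U : M.Edge → Mat n) (f : M.Face 2) : Mat n :=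
  match f.1.sort with
  | [a, b, c] => edgeVal M U a b * edgeVal M U b c - edgeVal M U a c
  | [a, b, d', c] =>
      edgeVal M U a b * edgeVal M U b c - edgeVal M U a d' * edgeVal M U d' c
  | _ => 0

/-- A local Lagrangian on matrix-valued functions on edges: a differentiable function whose value
at `v` is a differentiable function `Lv v` of the values of `U` at the edges with maximal vertex `v`
and of the values of the curvature at the 2-faces with maximal vertex `v`. -/
def IsLocalLagrangian (L : (M.Edge → Mat n) → V → ℝ) : Prop :=
  Differentiable ℝ L ∧
    ∃ Lv : (v : V) → (M.FacesEndingAt 1 v → Mat n) × (M.FacesEndingAt 2 v → Mat n) → ℝ,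
      (∀ v, Differentiable ℝ (Lv v)) ∧
      ∀ U v, L U v = Lv v (fun e => U e.1, fun f => curvature M U f.1)

/-- The action `ε L[U]`. -/
def action (L : (M.Edge → Mat n) → V → ℝ) (U : M.Edge → Mat n) : ℝ := ∑ v, L U v

end Cochains

/-! ### The scalar product `⟨u, v⟩ = Re Tr (u* v)` and orthogonal projections -/

/-- The scalar product `⟨u, v⟩ = Re Tr (u* v)` on `ℂ^{n×n}`. -/
def scalarProd (n : ℕ) : LinearMap.BilinForm ℝ (Mat n) :=
  LinearMap.mk₂ ℝ (fun u v => (Matrix.trace (uᴴ * v)).re)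
    (by intro u u' v; simp [Matrix.conjTranspose_add, add_mul])
    (by intro a u v; simp [Matrix.conjTranspose_smul])
    (by intro u v v'; simp [mul_add])
    (by intro a u v; simp)

theorem scalarProd_apply {n : ℕ} (u v : Mat n) :
    scalarProd n u v = (Matrix.trace (uᴴ * v)).re := rfl

theorem scalarProd_comm {n : ℕ} (u v : Mat n) : scalarProd n u v = scalarProd n v u := by
  rw [scalarProd_apply, scalarProd_apply, ← Complex.conj_re, ← Complex.star_def,
    ← Matrix.trace_conjTranspose, Matrix.conjTranspose_mul, Matrix.conjTranspose_conjTranspose]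

theorem eq_zero_of_scalarProd_self {n : ℕ} {u : Mat n} (h : scalarProd n u u = 0) : u = 0 := by
  have h1 : ∑ i, ∑ j, Complex.normSq (u j i) = 0 := by
    rw [← h, scalarProd_apply]
    simp [Matrix.trace, Matrix.mul_apply, Complex.normSq_apply]
  ext i j
  have h2 := (Finset.sum_eq_zero_iff_of_nonneg fun i _ =>
    Finset.sum_nonneg fun j _ => Complex.normSq_nonneg (u j i)).mp h1 j (Finset.mem_univ j)
  have h3 := (Finset.sum_eq_zero_iff_of_nonneg fun i _ =>
    Complex.normSq_nonneg (u i j)).mp h2 i (Finset.mem_univ i)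
  simpa using h3

theorem isCompl_orthogonal {n : ℕ} (T : Submodule ℝ (Mat n)) :
    IsCompl T ((scalarProd n).orthogonal T) := by
  have hr : (scalarProd n).IsRefl := fun u v h => by rw [scalarProd_comm, h]
  rw [LinearMap.BilinForm.isCompl_orthogonal_iff_disjoint hr, Submodule.disjoint_def]
  exact fun u hu hu' => eq_zero_of_scalarProd_self (hu' u hu)

/-- The orthogonal projection of `ℂ^{n×n}` onto a real linear subspace. -/
def orthProj {n : ℕ} (T : Submodule ℝ (Mat n)) (u : Mat n) : Mat n :=
  T.projectionOnto _ (isCompl_orthogonal T) u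

/-- `orthProj T u` is the unique element of `T` whose difference with `u` is orthogonal to `T`. -/
theorem orthProj_eq_iff {n : ℕ} (T : Submodule ℝ (Mat n)) (u w : Mat n) :
    orthProj T u = w ↔ w ∈ T ∧ ∀ x ∈ T, scalarProd n x (u - w) = 0 := by
  have hc := isCompl_orthogonal T
  have key : ∀ w ∈ T, (∀ x ∈ T, scalarProd n x (u - w) = 0) → orthProj T u = w := by
    intro w hw h
    have h1 : u = w + (u - w) := by abel
    have h2 : u - w ∈ (scalarProd n).orthogonal T := fun x hx => h x hx
    rw [h1, orthProj, map_add, Submodule.projectionOnto_apply_left hc ⟨w, hw⟩,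
      Submodule.projectionOnto_apply_right hc ⟨u - w, h2⟩]
    simp
  refine ⟨?_, fun h => key w h.1 h.2⟩
  obtain ⟨a, ha, b, hb, hab⟩ := Submodule.mem_sup.mp (hc.sup_eq_top ▸ Submodule.mem_top (x := u))
  have hba : ∀ x ∈ T, scalarProd n x (u - a) = 0 := by
    intro x hx
    rw [← hab, add_sub_cancel_left]
    exact hb x hx
  rintro rfl
  rw [key a ha hba]
  exact ⟨ha, hba⟩

/-! ### Gauge group and gauge group fields -/

/-- A smooth representation of the Lie group `G` by unitary transformations of `ℂ^n`. -/
structure UnitaryRep (E : Type*) [NormedAddCommGroup E] [NormedSpace ℝ E] (G : Type*) [Group G]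
    [TopologicalSpace G] [ChartedSpace E G] (n : ℕ) where
  hom : G →* Matrix.unitaryGroup (Fin n) ℂ
  smooth : ∀ i j, ContMDiff 𝓘(ℝ, E) 𝓘(ℝ, ℂ) ∞ fun g => (hom g : Mat n) i j

section Gauge

variable {E : Type*} [NormedAddCommGroup E] [NormedSpace ℝ E] {G : Type*} [Group G]
  [TopologicalSpace G] [ChartedSpace E G] {n : ℕ} (ρ : UnitaryRep E G n)

/-- The unitary matrix of a group element. -/
def UnitaryRep.mat (g : G) : Mat n := (ρ.hom g : Mat n)

/-- The differential at `u` of the map `G → ℂ^{n×n}`. -/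
def UnitaryRep.differential (u : G) : TangentSpace 𝓘(ℝ, E) u →ₗ[ℝ] Mat n where
  toFun ξ := Matrix.of fun i j => mfderiv 𝓘(ℝ, E) 𝓘(ℝ, ℂ) (fun g => ρ.mat g i j) u ξ
  map_add' ξ η := by
    ext i j
    exact map_add (mfderiv 𝓘(ℝ, E) 𝓘(ℝ, ℂ) (fun g => ρ.mat g i j) u) ξ η
  map_smul' a ξ := by
    ext i j
    exact map_smul (mfderiv 𝓘(ℝ, E) 𝓘(ℝ, ℂ) (fun g => ρ.mat g i j) u) a ξ

/-- The tangent subspace `T_u G ⊆ ℂ^{n×n}`. -/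
def UnitaryRep.tangent (u : G) : Submodule ℝ (Mat n) := LinearMap.range (ρ.differential u)

variable {V : Type*} [Fintype V] [LinearOrder V] {d : ℕ} (M : Spacetime V d)

/-- The matrix-valued function on edges given by a gauge group field. -/
def fieldMat (U : M.Edge → G) : M.Edge → Mat n := fun e => ρ.mat (U e)

/-- The function `Pr_{T_U G} j` on edges. -/
def projTangent (U : M.Edge → G) (j : M.Edge → Mat n) : M.Edge → Mat n :=
  fun e => orthProj (ρ.tangent (U e)) (j e)

/-- The gauge transformation `g* ⌣ Φ ⌣ g` of a function `Φ` on edges. -/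
def gaugeTransform (g : V → G) (Φ : M.Edge → Mat n) : M.Edge → Mat n :=
  fun e => (ρ.mat (g e.minV))ᴴ * Φ e * ρ.mat (g e.maxV)

/-- Gauge invariance of a Lagrangian: `L[g* ⌣ U ⌣ g] = L[U]` for all `G`-valued `U` and `g`. -/
def IsGaugeInvariant (L : (M.Edge → Mat n) → V → ℝ) : Prop :=
  ∀ (U : M.Edge → G) (g : V → G),
    L (gaugeTransform ρ M g (fieldMat ρ M U)) = L (fieldMat ρ M U)

/-- The gauge group field `U` is on shell: it is stationary for the action under the constraint that
the field is `G`-valued, i.e. the derivative of the action at `t = 0` vanishes along each variation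
`γ` of `U` through `G`-valued fields that is smooth near `t = 0`. -/
def IsOnShell (L : (M.Edge → Mat n) → V → ℝ) (U : M.Edge → G) : Prop :=
  ∀ γ : ℝ → M.Edge → G, γ 0 = U →
    (∀ e, ContMDiffAt 𝓘(ℝ, ℝ) 𝓘(ℝ, E) ∞ (fun t => γ t e) 0) →
    HasDerivAt (fun t => action M L (fieldMat ρ M (γ t))) 0 0

end Gauge

end LatticeGauge

end

open LatticeGauge

namespace LatticeGauge

variable {E : Type*} [NormedAddCommGroup E] [NormedSpace ℝ E] {G : Type*} [Group G]
  [TopologicalSpace G] [ChartedSpace E G] {n : ℕ}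

/-! This is Noether's argument for a gauge transformation moving at one vertex `v`. Such
transformations keep the field `G`-valued, so they are admissible variations. Along them the part
`L'` of the action is constant, and stationarity says that the derivative of the coupling to `j`
vanishes: for each `ξ` in the Lie algebra `T_1 G`, the sum of `⟨j, Uξ⟩` over edges ending at `v`
equals the sum of `⟨j, ξU⟩` over edges starting there (`sum_scalarProd_variation_eq_zero`).

Since `Uξ` and `ξU` lie in `T_U G`, the current may be replaced by its projection. Moving `U` to the
other side of the scalar product turns the identity into `⟨ξ, X⟩ = 0`, where `X` is the covariant
boundary at `v` in the form of `covBoundary_connection`. Translations carry each summand of `X` into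
`T_1 G`, so `ξ = X` is allowed, and `⟨X, X⟩ = 0` gives `X = 0`. -/

/-- `w` is the entrywise derivative at `0` of the matrix-valued curve `B`. -/
def HasVelocity (B : ℝ → Mat n) (w : Mat n) : Prop :=
  ∀ i k, HasDerivAt (fun t => B t i k) (w i k) 0

namespace HasVelocity

variable {B C : ℝ → Mat n} {w z : Mat n}

theorem const (A : Mat n) : HasVelocity (fun _ => A) 0 := fun i k => hasDerivAt_const 0 (A i k)

theorem mul (hB : HasVelocity B w) (hC : HasVelocity C z) :
    HasVelocity (fun t => B t * C t) (w * C 0 + B 0 * z) := by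
  intro i k
  simp only [Matrix.mul_apply, Matrix.add_apply, ← Finset.sum_add_distrib]
  exact HasDerivAt.fun_sum fun l _ => (hB i l).mul (hC l k)

theorem const_mul (hB : HasVelocity B w) (A : Mat n) : HasVelocity (fun t => A * B t) (A * w) := by
  simpa using (const A).mul hB

theorem mul_const (hB : HasVelocity B w) (A : Mat n) : HasVelocity (fun t => B t * A) (w * A) := by
  simpa using hB.mul (const A)

theorem conjTranspose (hB : HasVelocity B w) : HasVelocity (fun t => (B t)ᴴ) wᴴ :=
  fun i k => (hB k i).star

theorem unique (hB : HasVelocity B w) (hB' : HasVelocity B z) : w = z := by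
  ext i k
  exact (hB i k).unique (hB' i k)

theorem scalarProd (hB : HasVelocity B w) (A : Mat n) :
    HasDerivAt (fun t => scalarProd n A (B t)) (scalarProd n A w) 0 := by
  have h : HasDerivAt (fun t => (Aᴴ * B t).trace) (Aᴴ * w).trace 0 :=
    HasDerivAt.fun_sum fun i _ => hB.const_mul Aᴴ i i
  exact Complex.reCLM.hasFDerivAt.comp_hasDerivAt 0 h

end HasVelocity

/-! ### Adjoints and projections for the scalar product -/

theorem scalarProd_mul_left (A B C : Mat n) :
    scalarProd n (A * B) C = scalarProd n B (Aᴴ * C) := by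
  simp only [scalarProd_apply, Matrix.conjTranspose_mul, Matrix.mul_assoc]

theorem scalarProd_mul_right (A B C : Mat n) :
    scalarProd n (A * B) C = scalarProd n A (C * Bᴴ) := by
  rw [scalarProd_apply, scalarProd_apply, Matrix.conjTranspose_mul, Matrix.mul_assoc,
    Matrix.trace_mul_comm, Matrix.mul_assoc]

theorem orthProj_mem (T : Submodule ℝ (Mat n)) (u : Mat n) : orthProj T u ∈ T :=
  ((orthProj_eq_iff T u _).1 rfl).1

/-- Lets the projected current be exchanged for `j` itself when tested against tangent vectors. -/
theorem scalarProd_orthProj (T : Submodule ℝ (Mat n)) (u : Mat n) {x : Mat n} (hx : x ∈ T) :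
    scalarProd n x (orthProj T u) = scalarProd n x u := by
  have h := ((orthProj_eq_iff T u _).1 rfl).2 x hx
  rw [map_sub] at h
  exact (sub_eq_zero.1 h).symm

/-! ### Tangent spaces of the represented group -/

namespace UnitaryRep

variable (ρ : UnitaryRep E G n)

@[simp]
theorem mat_one : ρ.mat 1 = 1 := by simp [mat]

@[simp]
theorem mat_mul (g h : G) : ρ.mat (g * h) = ρ.mat g * ρ.mat h := by simp [mat]

@[simp]
theorem mat_inv (g : G) : ρ.mat g⁻¹ = (ρ.mat g)ᴴ := by
  rw [mat, map_inv]; rfl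

@[simp]
theorem conjTranspose_mul_mat (g : G) : (ρ.mat g)ᴴ * ρ.mat g = 1 := by
  rw [← mat_inv, ← mat_mul, inv_mul_cancel, mat_one]

@[simp]
theorem mat_mul_conjTranspose (g : G) : ρ.mat g * (ρ.mat g)ᴴ = 1 := by
  rw [← mat_inv, ← mat_mul, mul_inv_cancel, mat_one]

theorem mdifferentiableAt_mat (i k : Fin n) (u : G) :
    MDifferentiableAt 𝓘(ℝ, E) 𝓘(ℝ, ℂ) (fun g => ρ.mat g i k) u :=
  (ρ.smooth i k).mdifferentiableAt (by simp)

theorem hasVelocity_mat {γ : ℝ → G} (hγ : MDifferentiableAt 𝓘(ℝ, ℝ) 𝓘(ℝ, E) γ 0) :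
    HasVelocity (fun t => ρ.mat (γ t))
      (ρ.differential (γ 0) (mfderiv 𝓘(ℝ, ℝ) 𝓘(ℝ, E) γ 0 (1 : ℝ))) := by
  intro i k
  have h := ((ρ.mdifferentiableAt_mat i k (γ 0)).hasMFDerivAt.comp 0 hγ.hasMFDerivAt)
  let D : ℝ →L[ℝ] ℂ := (mfderiv 𝓘(ℝ, E) 𝓘(ℝ, ℂ) (fun g => ρ.mat g i k) (γ 0)).comp
    (mfderiv 𝓘(ℝ, ℝ) 𝓘(ℝ, E) γ 0)
  have hD : HasFDerivAt (fun t => ρ.mat (γ t) i k) D 0 := h.hasFDerivAt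
  exact hD.hasDerivAt

/-- The tangent subspace at `u` consists of the velocities of the smooth curves through `u`. -/
theorem mem_tangent_iff [IsManifold 𝓘(ℝ, E) ∞ G] {u : G} {w : Mat n} :
    w ∈ ρ.tangent u ↔ ∃ γ : ℝ → G, γ 0 = u ∧ ContMDiffAt 𝓘(ℝ, ℝ) 𝓘(ℝ, E) ∞ γ 0 ∧
      HasVelocity (fun t => ρ.mat (γ t)) w := by
  constructor
  · rintro ⟨ξ', rfl⟩
    let ξ : E := ξ'
    let φ := extChartAt 𝓘(ℝ, E) u
    -- The required curve is a straight line in the chart at `u`, pulled back to `G`.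
    let ℓ : ℝ → E := fun t => φ u + t • ξ
    have hℓ0 : ℓ 0 = φ u := by simp [ℓ]
    have hℓ : ContDiff ℝ ∞ ℓ := by fun_prop
    have hs : ContMDiffAt 𝓘(ℝ, E) 𝓘(ℝ, E) ∞ φ.symm (φ u) :=
      (contMDiffOn_extChartAt_symm (I := 𝓘(ℝ, E)) (n := ∞) u).contMDiffAt
        (extChartAt_target_mem_nhds u)
    have hγ : ContMDiffAt 𝓘(ℝ, ℝ) 𝓘(ℝ, E) ∞ (fun t => φ.symm (ℓ t)) 0 :=
      ContMDiffAt.comp (0 : ℝ) (by rw [hℓ0]; exact hs) hℓ.contMDiff.contMDiffAt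
    refine ⟨fun t => φ.symm (ℓ t), by simp [hℓ0, φ], hγ, ?_⟩
    intro i k
    have hf := ρ.mdifferentiableAt_mat i k u
    let D : E →L[ℝ] ℂ := mfderiv 𝓘(ℝ, E) 𝓘(ℝ, ℂ) (fun g => ρ.mat g i k) u
    -- The manifold derivative is by definition the derivative read in this same chart.
    have hd : HasFDerivWithinAt (fun x => ρ.mat (φ.symm x) i k) D (Set.range 𝓘(ℝ, E)) (φ u) :=
      hf.hasMFDerivAt.2
    rw [modelWithCornersSelf_coe, Set.range_id, hasFDerivWithinAt_univ] at hd
    have hl : HasDerivAt ℓ ξ 0 := by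
      simpa [ℓ] using ((hasDerivAt_id (0 : ℝ)).smul_const ξ).const_add (φ u)
    rw [← hℓ0] at hd
    exact hd.comp_hasDerivAt (0 : ℝ) hl
  · rintro ⟨γ, rfl, hγ, hw⟩
    rw [hw.unique (ρ.hasVelocity_mat (hγ.mdifferentiableAt (by simp)))]
    exact ⟨_, rfl⟩

variable [LieGroup 𝓘(ℝ, E) ∞ G]

/-- Translating a smooth curve in `G` translates its velocity; this links each `T_U G` with `T_1 G`.
-/
theorem mat_mul_mem_tangent (g : G) {u : G} {w : Mat n} (hw : w ∈ ρ.tangent u) :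
    ρ.mat g * w ∈ ρ.tangent (g * u) := by
  have := LieGroup.toContMDiffMul (I := 𝓘(ℝ, E)) (n := ∞) (G := G)
  rw [mem_tangent_iff] at hw ⊢
  obtain ⟨γ, rfl, hγ, hw⟩ := hw
  exact ⟨fun t => g * γ t, rfl, contMDiffAt_const.mul hγ, by simpa using hw.const_mul (ρ.mat g)⟩

theorem mul_mat_mem_tangent (g : G) {u : G} {w : Mat n} (hw : w ∈ ρ.tangent u) :
    w * ρ.mat g ∈ ρ.tangent (u * g) := by
  rw [mem_tangent_iff] at hw ⊢
  obtain ⟨γ, rfl, hγ, hw⟩ := hw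
  exact ⟨fun t => γ t * g, rfl, hγ.mul contMDiffAt_const, by simpa using hw.mul_const (ρ.mat g)⟩

/-- The elements of the Lie algebra are skew-Hermitian. -/
theorem conjTranspose_eq_neg {w : Mat n} (hw : w ∈ ρ.tangent 1) : wᴴ = -w := by
  obtain ⟨γ, h0, -, hw⟩ := ρ.mem_tangent_iff.1 hw
  -- Differentiate the constant product `U* U = 1` at `U = 1`.
  have h := hw.conjTranspose.mul hw
  simp only [conjTranspose_mul_mat, h0, mat_one, Matrix.conjTranspose_one, mul_one, one_mul] at h
  exact eq_neg_of_add_eq_zero_left (h.unique (HasVelocity.const 1))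

end UnitaryRep

/-! ### Gauge variations at a vertex and the conserved current -/

variable {V : Type*} [Fintype V] [LinearOrder V] {d : ℕ} (M : Spacetime V d)

theorem Spacetime.Face.minV_ne_maxV {M : Spacetime V d} (e : M.Edge) : e.minV ≠ e.maxV := by
  refine (Finset.min'_lt_max'_of_card e.1 ?_).ne
  rw [e.2.2]
  cases M.kind <;> simp [CellKind.numVertices]

/-- The `-1` in the connection cancels the ordinary boundary, leaving only parallel transport to
`v`. -/
theorem covBoundary_connection (W Φ : M.Edge → Mat n) (v : V) :
    covBoundary M (connection M W) Φ v =
      (∑ e : M.Edge with e.maxV = v, (W e)ᴴ * Φ e) - ∑ e : M.Edge with e.minV = v, Φ e * (W e)ᴴ := by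
  simp only [covBoundary, boundary, cap, cop, connection, Matrix.conjTranspose_sum,
    Matrix.conjTranspose_mul, Matrix.conjTranspose_sub,
    Matrix.conjTranspose_conjTranspose, sub_mul, mul_sub, one_mul, mul_one,
    Finset.sum_sub_distrib]
  abel

/-- Each edge has exactly one maximal vertex, so it is counted once. -/
theorem sum_trace_cap (j W : M.Edge → Mat n) :
    ∑ v, (Matrix.trace (cap M (fun e => (j e)ᴴ) W v)).re = ∑ e, scalarProd n (j e) (W e) := by
  simp only [cap, Matrix.trace_sum, Complex.re_sum, ← scalarProd_apply]
  exact Finset.sum_fiberwise _ _ _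

variable (ρ : UnitaryRep E G n)

theorem gaugeTransform_fieldMat (g : V → G) (U : M.Edge → G) :
    gaugeTransform ρ M g (fieldMat ρ M U) =
      fieldMat ρ M fun e => (g e.minV)⁻¹ * U e * g e.maxV := by
  funext e
  simp [gaugeTransform, fieldMat]

/-- The velocity of `g* ⌣ U ⌣ g` when `g` moves with the velocity `ξ` at the vertex `v` only. -/
theorem hasVelocity_gaugeTransform (U : M.Edge → G) (v : V) {γ : ℝ → G}
    {ξ : Mat n} (hξ : ξᴴ = -ξ) (hγ : HasVelocity (fun t => ρ.mat (γ t)) ξ) (e : M.Edge) :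
    HasVelocity
      (fun t => gaugeTransform ρ M (fun x => if x = v then γ t else 1) (fieldMat ρ M U) e)
      ((if e.maxV = v then ρ.mat (U e) * ξ else 0) -
        if e.minV = v then ξ * ρ.mat (U e) else 0) := by
  simp only [gaugeTransform, fieldMat]
  by_cases hmax : e.maxV = v
  -- Only one endpoint can move, so no product rule is needed.
  · have hmin : e.minV ≠ v := fun h => e.minV_ne_maxV (h.trans hmax.symm)
    simpa [hmax, hmin] using hγ.const_mul (ρ.mat (U e))
  · by_cases hmin : e.minV = v
    · simpa [hmax, hmin, hξ] using hγ.conjTranspose.mul_const (ρ.mat (U e))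
    · simpa [hmax, hmin] using HasVelocity.const (ρ.mat (U e))

variable [LieGroup 𝓘(ℝ, E) ∞ G]

/-- On shell, the current is orthogonal to the infinitesimal gauge variations at a vertex. -/
theorem sum_scalarProd_variation_eq_zero {L' L : (M.Edge → Mat n) → V → ℝ}
    (hL' : IsGaugeInvariant ρ M L') {j : M.Edge → Mat n}
    (hL : ∀ U v, L U v = L' U v - (Matrix.trace (cap M (fun e => (j e)ᴴ) U v)).re)
    {U : M.Edge → G} (hU : IsOnShell ρ M L U) (v : V) {ξ : Mat n} (hξ : ξ ∈ ρ.tangent 1) :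
    (∑ e : M.Edge with e.maxV = v, scalarProd n (j e) (ρ.mat (U e) * ξ)) -
      ∑ e : M.Edge with e.minV = v, scalarProd n (j e) (ξ * ρ.mat (U e)) = 0 := by
  obtain ⟨γ, h0, hγ, hv⟩ := ρ.mem_tangent_iff.1 hξ
  let g : ℝ → V → G := fun t x => if x = v then γ t else 1
  have hg : ∀ x, ContMDiffAt 𝓘(ℝ, ℝ) 𝓘(ℝ, E) ∞ (fun t => g t x) 0 := by
    intro x
    by_cases hx : x = v
    · simpa [g, hx] using hγ
    · simpa [g, hx] using contMDiffAt_const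
  have hS := hU (fun t e => (g t e.minV)⁻¹ * U e * g t e.maxV)
    (by funext e; simp [g, h0]) fun e => ((hg _).inv.mul contMDiffAt_const).mul (hg _)
  -- By gauge invariance the `L'` term does not depend on `t`; only the coupling to `j` varies.
  have hact : ∀ t, action M L (fieldMat ρ M fun e => (g t e.minV)⁻¹ * U e * g t e.maxV) =
      (∑ x, L' (fieldMat ρ M U) x) -
        ∑ e, scalarProd n (j e) (gaugeTransform ρ M (g t) (fieldMat ρ M U) e) := by
    intro t
    rw [← gaugeTransform_fieldMat]
    simp only [action, hL, Finset.sum_sub_distrib, sum_trace_cap, hL' U (g t)]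
  simp only [hact] at hS
  have hD := (HasDerivAt.fun_sum fun e (_ : e ∈ Finset.univ) =>
    (hasVelocity_gaugeTransform M ρ U v (ρ.conjTranspose_eq_neg hξ) hv e).scalarProd
      (j e)).const_sub (∑ x, L' (fieldMat ρ M U) x)
  have h := neg_eq_zero.1 (hD.unique hS)
  have hite : ∀ (A B : Mat n) (p : Prop) [Decidable p],
      scalarProd n A (if p then B else 0) = if p then scalarProd n A B else 0 := by
    intro A B p _
    split_ifs <;> simp
  simpa only [map_sub, hite, Finset.sum_sub_distrib, ← Finset.sum_filter] using h

end LatticeGauge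

theorem mainTheorem8 {V : Type*} [Fintype V] [LinearOrder V] {d : ℕ} (M : Spacetime V d) {n : ℕ}
    {E : Type*} [NormedAddCommGroup E] [NormedSpace ℝ E] [FiniteDimensional ℝ E]
    {G : Type*} [Group G] [TopologicalSpace G] [ChartedSpace E G] [LieGroup 𝓘(ℝ, E) ∞ G]
    (ρ : UnitaryRep E G n)
    (L' : (M.Edge → Mat n) → V → ℝ) (hL' : IsGaugeInvariant ρ M L')
    (j : M.Edge → Mat n)
    (L : (M.Edge → Mat n) → V → ℝ)
    (hL : ∀ U v, L U v = L' U v - (Matrix.trace (cap M (fun e => (j e)ᴴ) U v)).re)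
    (hloc : IsLocalLagrangian M L)
    (U : M.Edge → G) (hU : IsOnShell ρ M L U) :
    covBoundary M (connection M (fieldMat ρ M U)) (projTangent ρ M U j) = 0 := by
  funext v
  set X := covBoundary M (connection M (fieldMat ρ M U)) (projTangent ρ M U j) v with hX
  rw [covBoundary_connection] at hX
  -- Translation by `(U e)⁻¹`, whose matrix is `U*`, sends `T_U G` to `T_1 G`.
  have hmem : X ∈ ρ.tangent 1 := by
    rw [hX]
    refine sub_mem (sum_mem fun e _ => ?_) (sum_mem fun e _ => ?_)
    · simpa [fieldMat, projTangent] using ρ.mat_mul_mem_tangent (U e)⁻¹ (orthProj_mem (ρ.tangent (U e)) (j e))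
    · simpa [fieldMat, projTangent] using ρ.mul_mat_mem_tangent (U e)⁻¹ (orthProj_mem (ρ.tangent (U e)) (j e))
  refine eq_zero_of_scalarProd_self (u := X) ?_
  -- The infinitesimal gauge transformation used as a test is `X` itself.
  have h := sum_scalarProd_variation_eq_zero M ρ hL' hL hU v hmem
  rw [← h]
  refine (congrArg (scalarProd n X) hX).trans ?_
  rw [map_sub, map_sum, map_sum]
  congr 1
  · refine Finset.sum_congr rfl fun e _ => ?_
    have ht : ρ.mat (U e) * X ∈ ρ.tangent (U e) := by
      simpa using ρ.mat_mul_mem_tangent (U e) hmem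
    rw [scalarProd_comm (j e), ← scalarProd_orthProj _ _ ht, scalarProd_mul_left]
    rfl
  · refine Finset.sum_congr rfl fun e _ => ?_
    have ht : X * ρ.mat (U e) ∈ ρ.tangent (U e) := by
      simpa using ρ.mul_mat_mem_tangent (U e) hmem
    rw [scalarProd_comm (j e), ← scalarProd_orthProj _ _ ht, scalarProd_mul_right]
    rfl
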